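/- Let $X$ be a real separated (Hausdorff) locally convex space with topological dual $X^*$ endowed with the $w^*$-topology. Let $T$ be a nonempty compact Hausdorff space and let $f_t : X \to \mathbb{R}\cup\{+\infty\}$, $t\in T$, be proper, convex and lower semicontinuous functions such that, for every $z\in X$, the mapping $t\mapsto f_t(z)$ is upper semicontinuous on $T$. Put $f := \sup_{t\in T} f_t$. For a function $g: X\to[-\infty,+\infty]$, a point $x$ with $g(x)\in\mathbb{R}$ and $\varepsilon\ge 0$, let $$\partial_\varepsilon g(x) := \{x^*\in X^* : g(y)\ge g(x)+\langle x^*, y-x\rangle-\varepsilon \text{ for all } y\in X\}, \qquad \partial g(x):=\partial_0 g(x)$$ (and both sets are empty when $g(x)\notin\mathbb{R}$). Let $\overline{\operatorname{co}}$ denote the $w^*$-closed convex hull. Let $x\in X$ satisfy $f(x)<+\infty$ and $\inf_{t\in T} f_t(x)>-\infty$, and let $T(x):=\{t\in T : f_t(x) = f(x)\}$. Then $$\partial f(x)=\bigcap_{\varepsilon>0}\overline{\operatorname{co}}\left(\Big(\bigcup_{t\in T(x)}\partial_\varepsilon f_t(x)\Big)+\Big(\bigcup_{t\in T\setminus T(x)}\{0,\varepsilon\}\,\partial_\varepsilon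 f_t(x)\Big)\right),$$ where $+$ is the Minkowski sum, $\{0,\varepsilon\}A:=\{\lambda a : \lambda\in\{0,\varepsilon\},\ a\in A\}$, and the second union is understood as $\{0\}$ when $T(x)=T$. If, in addition, $f$ attains its minimum over $X$ at $x$, then also $$\partial f(x)=\bigcap_{\varepsilon>0}\overline{\operatorname{co}}\left(\Big(\bigcup_{t\in T(x)}\partial_\varepsilon f_t(x)\Big)\cup\Big(\bigcup_{t\in T\setminus T(x)}\varepsilon\,\partial_\varepsilon f_t(x)\Big)\right).$$ -/

import Mathlib

open scoped Pointwise

noncomputable section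

section Defs

variable {X : Type*} [AddCommGroup X] [Module ℝ X] [TopologicalSpace X]

/-- The class `Γ₀(X)` of proper, convex, lower semicontinuous functions with values in `[-∞, +∞]`.
Convexity is convexity of the epigraph in `X × ℝ`. -/
structure IsGammaZero (f : X → EReal) : Prop where
  ne_bot : ∀ x, f x ≠ ⊥
  exists_lt_top : ∃ x, f x < ⊤
  convex_epigraph : Convex ℝ {p : X × ℝ | f p.1 ≤ (p.2 : EReal)}
  lsc : LowerSemicontinuous f

/-- The `ε`-subdifferential `∂_ε f(x)`, a subset of the topological dual with its `w*`-topology.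
It is empty when `f x` is not a real number or when `ε < 0`. -/
def epsSubdiff (ε : ℝ) (f : X → EReal) (x : X) : Set (WeakDual ℝ X) :=
  {xs | 0 ≤ ε ∧ f x ≠ ⊤ ∧ f x ≠ ⊥ ∧ ∀ y : X, f x + ((xs (y - x) - ε : ℝ) : EReal) ≤ f y}

/-- The (Fenchel) subdifferential `∂f(x) = ∂_0 f(x)`. -/
def subdiff (f : X → EReal) (x : X) : Set (WeakDual ℝ X) :=
  epsSubdiff 0 f x

/-- The `w*`-closed convex hull of a subset of the dual. -/
def wstarClosedConvexHull [IsTopologicalAddGroup X] [ContinuousSMul ℝ X]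
    (A : Set (WeakDual ℝ X)) : Set (WeakDual ℝ X) :=
  closure (convexHull ℝ A)

end Defs

/-- The pointwise supremum of a family of functions. -/
def supFun {T X : Type*} (f : T → X → EReal) : X → EReal :=
  fun x => ⨆ t, f t x

/-- The `ε`-active indices at `x`: those `t` with `f_t(x) ≥ f(x) - ε`, where `f = sup_t f_t`. -/
def epsActive {T X : Type*} (ε : ℝ) (f : T → X → EReal) (x : X) : Set T :=
  {t | supFun f x - (ε : EReal) ≤ f t x}

/-- The active indices `T(x)` at `x`. -/
def active {T X : Type*} (f : T → X → EReal) (x : X) : Set T :=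
  epsActive 0 f x

/-- The union `⋃_{i ∈ I} S i`, with the convention that the union over `I = ∅` is `{0}`. -/
def unionOrZero {ι E : Type*} [Zero E] (I : Set ι) (S : ι → Set E) : Set E :=
  {e | (∃ i ∈ I, e ∈ S i) ∨ (I = ∅ ∧ e = 0)}

end

open Filter Topology Set

/-! ### Separation and the ε-subdifferential of one function -/

section Gamma

variable {X : Type*} [AddCommGroup X] [Module ℝ X] [TopologicalSpace X]

/-! Closed convex hulls are tested direction by direction. If `p` bounds the right-hand set along
`z`, it bounds the active ε-subdifferentials, while each inactive one has some finite bound. By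
Hahn-Banach (`IsGammaZero.exists_lt_of_epsSubdiff_le`) such a bound gives a strict inequality for `f
t` at some `x + s • z`. Upper semicontinuity in `t` spreads it to nearby indices, convexity carries
it to shorter steps, and compactness makes the step uniform. So `f` grows at rate at most `p' > p`
along `z`, which bounds its subgradients. Conversely, ε-subgradient inequalities pass to the hull,
and the lower bound on `f t x` makes the inactive terms vanish as ε → 0. -/

theorem EReal.coe_le_iff_forall_real {a : ℝ} {b : EReal} :
    (a : EReal) ≤ b ↔ ∀ r : ℝ, b ≤ r → a ≤ r := by
  refine ⟨fun h r hr => by exact_mod_cast h.trans hr, fun h => ?_⟩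
  induction b with
  | bot => linarith [h (a - 1) bot_le]
  | top => exact le_top
  | coe b => exact_mod_cast h b le_rfl

theorem mem_epsSubdiff_iff {g : X → EReal} {x : X} {γ ε : ℝ} (hγ : g x = γ)
    {xs : WeakDual ℝ X} :
    xs ∈ epsSubdiff ε g x ↔ 0 ≤ ε ∧ ∀ y (r : ℝ), g y ≤ r → γ + (xs (y - x) - ε) ≤ r := by
  simp only [epsSubdiff, mem_ofPred_eq, hγ, ne_eq, EReal.coe_ne_top, EReal.coe_ne_bot,
    not_false_eq_true, true_and, ← EReal.coe_add, EReal.coe_le_iff_forall_real]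

/-- Using upper bounds `a`, `b` instead of exact values lets one pair serve all indices near a given
one. -/
theorem IsGammaZero.ray_le {g : X → EReal} (hg : IsGammaZero g) {x z : X} {s r a b : ℝ}
    (hs : 0 < s) (hr : 0 ≤ r) (hrs : r ≤ s) (ha : g x ≤ a) (hb : g (x + s • z) ≤ b) :
    g (x + r • z) ≤ ((a + r * ((b - a) / s) : ℝ) : EReal) := by
  have h := hg.convex_epigraph (x := (x, a)) (by exact ha) (y := (x + s • z, b)) (by exact hb)
    (a := 1 - r / s) (b := r / s) (by rw [sub_nonneg, div_le_one hs]; exact hrs) (by positivity)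
    (by ring)
  have e1 : (1 - r / s) • x + (r / s) • (x + s • z) = x + r • z := by
    rw [smul_add, smul_smul, div_mul_cancel₀ _ hs.ne']
    module
  have e2 : (1 - r / s) * a + (r / s) * b = a + r * ((b - a) / s) := by
    field_simp
    ring
  simp only [Prod.smul_mk, Prod.mk_add_mk, e1, smul_eq_mul, e2] at h
  exact h

theorem IsGammaZero.isClosed_epigraph {g : X → EReal} (hg : IsGammaZero g) :
    IsClosed {p : X × ℝ | g p.1 ≤ (p.2 : EReal)} :=
  hg.lsc.isClosed_epigraph.preimage
    (continuous_fst.prodMk (continuous_coe_real_ereal.comp continuous_snd))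

variable [IsTopologicalAddGroup X] [ContinuousSMul ℝ X]

/-- A point lies in the `w*`-closed convex hull of `C` as soon as it is dominated by every upper
bound of `C` in every direction. -/
theorem mem_wstarClosedConvexHull_of_forall_le {C : Set (WeakDual ℝ X)} {xs : WeakDual ℝ X}
    (h : ∀ (z : X) (p : ℝ), (∀ u ∈ C, u z ≤ p) → xs z ≤ p) : xs ∈ wstarClosedConvexHull C := by
  by_contra hn
  have : LocallyConvexSpace ℝ (WeakDual ℝ X) :=
    inferInstanceAs (LocallyConvexSpace ℝ (WeakBilin (topDualPairing ℝ X)))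
  obtain ⟨F, p, hF, hp⟩ := geometric_hahn_banach_closed_point
    (convex_convexHull ℝ C).closure isClosed_closure hn
  obtain ⟨z, hz⟩ := LinearMap.dualEmbedding_surjective (topDualPairing ℝ X) F
  have hz' : ∀ u : WeakDual ℝ X, F u = u z := fun u => by rw [← hz]; rfl
  have := h z p fun u hu => by
    rw [← hz']
    exact (hF u (subset_closure (subset_convexHull ℝ C hu))).le
  rw [← hz'] at this
  exact this.not_gt hp

theorem apply_le_of_mem_wstarClosedConvexHull {C : Set (WeakDual ℝ X)} {xs : WeakDual ℝ X}
    (hxs : xs ∈ wstarClosedConvexHull C) {z : X} {p : ℝ} (h : ∀ u ∈ C, u z ≤ p) : xs z ≤ p := by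
  have hconv : Convex ℝ {u : WeakDual ℝ X | u z ≤ p} := by
    intro u hu v hv a b ha hb hab
    have e : (a • u + b • v) z = a * u z + b * v z := rfl
    simp only [mem_ofPred_eq] at hu hv ⊢
    rw [e]
    have h1 := mul_le_mul_of_nonneg_left hu ha
    have h2 := mul_le_mul_of_nonneg_left hv hb
    have h3 : a * p + b * p = p := by rw [← add_mul, hab, one_mul]
    linarith
  exact closure_minimal (convexHull_min h hconv)
    (isClosed_le (WeakDual.eval_continuous z) continuous_const) hxs

variable [LocallyConvexSpace ℝ X]

/-- The support function of the `ε`-subdifferential dominates the `ε`-directional derivative. -/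
theorem IsGammaZero.exists_lt_of_epsSubdiff_le {g : X → EReal} (hg : IsGammaZero g) {x z : X}
    {γ ε p q : ℝ} (hγ : g x = γ) (hε : 0 < ε) (hpq : p < q)
    (h : ∀ u ∈ epsSubdiff ε g x, u z ≤ p) :
    ∃ s : ℝ, 0 < s ∧ g (x + s • z) < ((γ - ε + s * q : ℝ) : EReal) := by
  by_contra! hc
  obtain ⟨m, hpm, hmq⟩ := exists_between hpq
  -- `K` is a segment of slope `m` starting ε below the graph. Its length makes `S * (m - p) = ε`,
  -- so the separating functional violates the bound `p` at the far end.
  set S : ℝ := ε / (m - p) with hS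
  have hSpos : 0 < S := div_pos hε (sub_pos.2 hpm)
  let K : Set (X × ℝ) := (fun s : ℝ => (x + s • z, γ - ε + s * m)) '' Icc 0 S
  have hK : IsCompact K := isCompact_Icc.image (by fun_prop)
  have hKc : Convex ℝ K := by
    rintro _ ⟨s, hs, rfl⟩ _ ⟨t, ht, rfl⟩ a b ha hb hab
    refine ⟨a * s + b * t, convex_Icc 0 S hs ht ha hb hab, ?_⟩
    obtain rfl : b = 1 - a := by linarith
    ext
    · simp only [Prod.smul_mk, Prod.mk_add_mk]
      module
    · simp only [Prod.smul_mk, Prod.mk_add_mk, smul_eq_mul]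
      ring
  have hdisj : Disjoint K {p : X × ℝ | g p.1 ≤ (p.2 : EReal)} := by
    rw [Set.disjoint_left]
    rintro _ ⟨s, hs, rfl⟩ hmem
    simp only [mem_ofPred_eq] at hmem
    rcases hs.1.eq_or_lt with rfl | hs0
    · simp only [zero_smul, add_zero, hγ, zero_mul] at hmem
      have : γ ≤ γ - ε := by exact_mod_cast hmem
      linarith
    · have : γ - ε + s * q ≤ γ - ε + s * m := by exact_mod_cast (hc s hs0).trans hmem
      nlinarith
  obtain ⟨F, u, v, hFK, huv, hFE⟩ := geometric_hahn_banach_compact_closed hKc hK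
    hg.convex_epigraph hg.isClosed_epigraph hdisj
  let φ : X →L[ℝ] ℝ := F.comp (ContinuousLinearMap.inl ℝ X ℝ)
  let c : ℝ := F (0, 1)
  have hF : ∀ y r, F (y, r) = φ y + r * c := fun y r => by
    have : ((y, r) : X × ℝ) = (y, 0) + r • (0, 1) := by simp
    rw [this, map_add, map_smul, smul_eq_mul]
    rfl
  have hlt : ∀ s ∈ Icc 0 S, ∀ y (r : ℝ), g y ≤ r →
      φ x + s * φ z + (γ - ε + s * m) * c < φ y + r * c := fun s hs y r hr => by
    have h1 := hFK _ ⟨s, hs, rfl⟩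
    have h2 := hFE (y, r) hr
    simp only [hF, map_add, map_smul, smul_eq_mul] at h1 h2
    linarith
  -- The hyperplane is not vertical: `(x, γ)` lies directly above the start of `K`.
  have hc0 : 0 < c := by
    have := hlt 0 ⟨le_rfl, hSpos.le⟩ x γ hγ.le
    by_contra! hcn
    nlinarith
  have hu : StrongDual.toWeakDual (-c⁻¹ • φ) ∈ epsSubdiff ε g x := by
    refine (mem_epsSubdiff_iff hγ).2 ⟨hε.le, fun y r hr => ?_⟩
    have h1 := hlt 0 ⟨le_rfl, hSpos.le⟩ y r hr
    have h2 : γ + (-c⁻¹ * φ y - -c⁻¹ * φ x - ε) = ((γ - ε) * c - (φ y - φ x)) / c := by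
      field_simp
      ring
    simp only [StrongDual.toWeakDual_apply, smul_apply, map_sub, smul_eq_mul]
    rw [h2, div_le_iff₀ hc0]
    linarith
  have h1 := h _ hu
  have h2 := hlt S ⟨hSpos.le, le_rfl⟩ x γ hγ.le
  have h3 : S * (m - p) = ε := div_mul_cancel₀ _ (sub_pos.2 hpm).ne'
  simp only [StrongDual.toWeakDual_apply, smul_apply, smul_eq_mul] at h1
  have h4 : -φ z ≤ p * c := by
    rw [neg_mul, ← mul_neg, inv_mul_le_iff₀ hc0] at h1
    linarith
  have h5 : S * -φ z ≤ S * (p * c) := mul_le_mul_of_nonneg_left h4 hSpos.le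
  have h6 : S * (m - p) * c = ε * c := by rw [h3]
  linarith

theorem IsGammaZero.epsSubdiff_nonempty {g : X → EReal} (hg : IsGammaZero g) {x : X}
    {γ ε : ℝ} (hγ : g x = γ) (hε : 0 < ε) : (epsSubdiff ε g x).Nonempty := by
  by_contra! hne
  -- Over an empty set even the bound `-1` in direction `0` holds.
  obtain ⟨s, hs, h⟩ := hg.exists_lt_of_epsSubdiff_le (z := 0) (p := -1) (q := 0) hγ hε
    (by norm_num) (by simp [hne])
  rw [smul_zero, add_zero, hγ] at h
  have : γ < γ - ε + s * 0 := by exact_mod_cast h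
  linarith

end Gamma

/-! ### Growth of the supremum along a ray -/

section Sup

variable {X T : Type*} {f : T → X → EReal} {x : X}

theorem mem_active_iff {t : T} : t ∈ active f x ↔ f t x = supFun f x := by
  simp only [active, epsActive, mem_ofPred_eq, EReal.coe_zero, sub_zero]
  exact ⟨fun h => le_antisymm (le_iSup (fun t => f t x) t) h, fun h => h.ge⟩

theorem active_nonempty [Nonempty T] [TopologicalSpace T] [CompactSpace T]
    (husc : UpperSemicontinuous (fun t => f t x)) : (active f x).Nonempty := by
  obtain ⟨t, -, ht⟩ := (husc.upperSemicontinuousOn univ).exists_isMaxOn univ_nonempty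
    isCompact_univ
  exact ⟨t, mem_active_iff.2
    (le_antisymm (le_iSup (fun t => f t x) t) (iSup_le fun s => ht (mem_univ s)))⟩

variable [AddCommGroup X] [Module ℝ X] [TopologicalSpace X]
  [IsTopologicalAddGroup X] [ContinuousSMul ℝ X] [LocallyConvexSpace ℝ X]

/-- A direction bounded on the `ε`-subdifferentials of the active functions by `p`, and bounded on
each of the other `ε`-subdifferentials, is bounded by `p` on the subdifferential of the supremum. -/
theorem apply_le_of_mem_subdiff_supFun [TopologicalSpace T] [CompactSpace T]
    (hf : ∀ t, IsGammaZero (f t)) (husc : ∀ z : X, UpperSemicontinuous (fun t => f t z))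
    {F : ℝ} (hF : supFun f x = F) {γ : T → ℝ} (hγ : ∀ t, f t x = γ t) {ε p : ℝ} (hε : 0 < ε)
    {z : X} (hact : ∀ t ∈ active f x, ∀ u ∈ epsSubdiff ε (f t) x, u z ≤ p)
    (hnact : ∀ t ∉ active f x, ∃ q : ℝ, ∀ u ∈ epsSubdiff ε (f t) x, u z ≤ q)
    {xs : WeakDual ℝ X} (hxs : xs ∈ subdiff (supFun f) x) : xs z ≤ p := by
  refine le_of_forall_gt_imp_ge_of_dense fun p' hp' => ?_
  have hle : ∀ t, f t x ≤ F := fun t => hF ▸ le_iSup (fun t => f t x) t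
  have hloc : ∀ t, ∃ s : ℝ, 0 < s ∧ ∀ᶠ t' in 𝓝 t, ∀ r, 0 < r → r ≤ s →
      f t' (x + r • z) ≤ ((F + r * p' : ℝ) : EReal) := fun t => by
    by_cases ht : t ∈ active f x
    · have hγF : γ t = F := by
        rw [mem_active_iff, hF, hγ] at ht
        exact_mod_cast ht
      obtain ⟨s, hs, hlt⟩ := (hf t).exists_lt_of_epsSubdiff_le (hγ t) hε hp' (hact t ht)
      refine ⟨s, hs, (husc _ t _ hlt).mono fun t' ht' r hr hrs => ?_⟩
      refine ((hf t').ray_le hs hr.le hrs (hle t') ht'.le).trans ?_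
      rw [EReal.coe_le_coe_iff]
      gcongr
      rw [div_le_iff₀ hs, hγF]
      linarith
    · obtain ⟨q, hq⟩ := hnact t ht
      obtain ⟨s, hs, hlt⟩ := (hf t).exists_lt_of_epsSubdiff_le (hγ t) hε (lt_add_one q) hq
      set b := γ t - ε + s * (q + 1)
      have hγF : γ t < F := by
        refine lt_of_le_of_ne (by exact_mod_cast (hγ t) ▸ hle t) fun h => ht ?_
        rw [mem_active_iff, hF, hγ, h]
      -- The slope `k` may exceed `p'`, but for short steps the gap `F - a` absorbs the excess.
      obtain ⟨a, hta, haF⟩ := exists_between hγF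
      set k := (b - a) / s
      have hden : 0 < |k - p'| + 1 := by positivity
      refine ⟨min s ((F - a) / (|k - p'| + 1)), lt_min hs (div_pos (sub_pos.2 haF) hden), ?_⟩
      have hxa : f t x < (a : EReal) := by
        rw [hγ]
        exact_mod_cast hta
      filter_upwards [husc _ t _ hlt, husc _ t _ hxa] with t' h1 h2 r hr hrs
      refine ((hf t').ray_le hs hr.le (hrs.trans (min_le_left _ _)) h2.le h1.le).trans ?_
      rw [EReal.coe_le_coe_iff]
      have h3 := (le_div_iff₀ hden).1 (hrs.trans (min_le_right _ _))
      have h4 : r * (k - p') ≤ r * (|k - p'| + 1) := by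
        gcongr
        linarith [le_abs_self (k - p')]
      linarith
  obtain ⟨s, hs, hbd⟩ : ∃ s : ℝ, 0 < s ∧ ∀ t ∈ (univ : Set T), ∀ r, 0 < r → r ≤ s →
      f t (x + r • z) ≤ ((F + r * p' : ℝ) : EReal) := by
    refine isCompact_univ.induction_on (p := fun A : Set T => ∃ s : ℝ, 0 < s ∧ ∀ t ∈ A, ∀ r,
      0 < r → r ≤ s → f t (x + r • z) ≤ ((F + r * p' : ℝ) : EReal)) ⟨1, one_pos, by simp⟩ ?_ ?_ ?_
    · rintro A B hAB ⟨s, hs, h⟩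
      exact ⟨s, hs, fun t ht => h t (hAB ht)⟩
    · rintro A B ⟨s, hs, h⟩ ⟨s', hs', h'⟩
      refine ⟨min s s', lt_min hs hs', ?_⟩
      rintro t (ht | ht) r hr hrs
      · exact h t ht r hr (hrs.trans (min_le_left _ _))
      · exact h' t ht r hr (hrs.trans (min_le_right _ _))
    · intro t _
      obtain ⟨s, hs, h⟩ := hloc t
      exact ⟨_, mem_nhdsWithin_of_mem_nhds h, s, hs, fun t' ht' => ht'⟩
  have h := ((mem_epsSubdiff_iff hF).1 hxs).2 (x + s • z) (F + s * p')
    (iSup_le fun t => hbd t (mem_univ t) s hs le_rfl)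
  rw [add_sub_cancel_left, map_smul, smul_eq_mul, sub_zero] at h
  exact le_of_mul_le_mul_left (by linarith) hs

end Sup

/-! ### The two subdifferential formulas -/

theorem mainTheorem11
    {X : Type*} [AddCommGroup X] [Module ℝ X] [TopologicalSpace X] [IsTopologicalAddGroup X]
    [ContinuousSMul ℝ X] [LocallyConvexSpace ℝ X] [T2Space X]
    {T : Type*} [Nonempty T] [TopologicalSpace T] [CompactSpace T] [T2Space T]
    (f : T → X → EReal) (hf : ∀ t, IsGammaZero (f t))
    (husc : ∀ z : X, UpperSemicontinuous (fun t => f t z))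
    (x : X) (hx : supFun f x < ⊤) (hinf : ⊥ < ⨅ t, f t x) :
    (subdiff (supFun f) x =
      ⋂ (ε : ℝ) (_ : 0 < ε), wstarClosedConvexHull
        ((⋃ t ∈ active f x, epsSubdiff ε (f t) x) +
          unionOrZero (active f x)ᶜ (fun t => ({0, ε} : Set ℝ) • epsSubdiff ε (f t) x))) ∧
    ((∀ y : X, supFun f x ≤ supFun f y) →
      subdiff (supFun f) x =
        ⋂ (ε : ℝ) (_ : 0 < ε), wstarClosedConvexHull
          ((⋃ t ∈ active f x, epsSubdiff ε (f t) x) ∪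
            (⋃ t ∈ (active f x)ᶜ, ε • epsSubdiff ε (f t) x))) := by
  have hle : ∀ t y, f t y ≤ supFun f y := fun t y => le_iSup (fun t => f t y) t
  obtain ⟨m, hm⟩ : ∃ m : ℝ, ∀ t, (m : EReal) ≤ f t x := by
    obtain ⟨m, -, hm⟩ := EReal.lt_iff_exists_real_btwn.1 hinf
    exact ⟨m, fun t => hm.le.trans (iInf_le (fun t => f t x) t)⟩
  have hfin : ∀ t, ∃ γ : ℝ, f t x = γ := fun t =>
    ⟨(f t x).toReal, (EReal.coe_toReal ((hle t x).trans_lt hx).ne ((hf t).ne_bot x)).symm⟩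
  choose γ hγ using hfin
  obtain ⟨t₀, ht₀⟩ := active_nonempty (f := f) (husc x)
  have hF : supFun f x = (γ t₀ : EReal) := by rw [← hγ, mem_active_iff.1 ht₀]
  set F := γ t₀
  have hmγ : ∀ t, m ≤ γ t := fun t => by exact_mod_cast (hγ t) ▸ hm t
  have hγact : ∀ t ∈ active f x, γ t = F := fun t ht => by
    have := mem_active_iff.1 ht
    rw [hF, hγ] at this
    exact_mod_cast this
  have hsub : ∀ {ε : ℝ} {t : T} {u : WeakDual ℝ X}, u ∈ epsSubdiff ε (f t) x → ∀ {y : X} {r : ℝ},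
      supFun f y ≤ r → u (y - x) ≤ r - γ t + ε := fun {ε t u} hu {y r} hr => by
    linarith [((mem_epsSubdiff_iff (hγ t)).1 hu).2 y r ((hle t y).trans hr)]
  have hlim : ∀ {a b c : ℝ}, (∀ ε : ℝ, 0 < ε → ε < 1 → a ≤ b + ε * c) → a ≤ b :=
    fun {a b c} h => by
      have ht : Tendsto (fun ε : ℝ => b + ε * c) (𝓝[>] 0) (𝓝 b) := by
        have : Continuous fun ε : ℝ => b + ε * c := by fun_prop
        simpa using (this.tendsto 0).mono_left nhdsWithin_le_nhds
      refine ge_of_tendsto ht ?_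
      filter_upwards [Ioo_mem_nhdsGT one_pos] with ε hε using h ε hε.1 hε.2
  refine ⟨subset_antisymm ?_ ?_, fun hmin => subset_antisymm ?_ ?_⟩
  · intro xs hxs
    simp only [mem_iInter]
    refine fun ε hε => mem_wstarClosedConvexHull_of_forall_le fun z p hp => ?_
    have hzero : (0 : WeakDual ℝ X) ∈ unionOrZero (active f x)ᶜ
        (fun t => ({0, ε} : Set ℝ) • epsSubdiff ε (f t) x) := by
      rcases (active f x)ᶜ.eq_empty_or_nonempty with h | ⟨t, ht⟩
      · exact Or.inr ⟨h, rfl⟩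
      · obtain ⟨u, hu⟩ := (hf t).epsSubdiff_nonempty (hγ t) hε
        exact Or.inl ⟨t, ht, Set.mem_smul.2 ⟨0, by simp, u, hu, zero_smul _ _⟩⟩
    refine apply_le_of_mem_subdiff_supFun hf husc hF hγ hε (fun t ht u hu => ?_)
      (fun t ht => ?_) hxs
    · exact hp u (Set.mem_add.2 ⟨u, mem_biUnion ht hu, 0, hzero, add_zero u⟩)
    -- With an active `v` fixed, the bound on `v + ε • u` bounds `u`; this is why the factor ε is
    -- needed beside 0.
    · obtain ⟨v, hv⟩ := (hf t₀).epsSubdiff_nonempty (hγ t₀) hε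
      refine ⟨(p - v z) / ε, fun u hu => ?_⟩
      have h1 : (v + ε • u) z ≤ p := hp _ (Set.mem_add.2 ⟨v, mem_biUnion ht₀ hv, ε • u,
        Or.inl ⟨t, ht, Set.smul_mem_smul (by simp) hu⟩, rfl⟩)
      have h2 : (v + ε • u) z = v z + ε * u z := rfl
      rw [le_div_iff₀ hε]
      linarith
  · intro xs hxs
    simp only [mem_iInter] at hxs
    refine (mem_epsSubdiff_iff hF).2 ⟨le_rfl, fun y r hr => ?_⟩
    suffices xs (y - x) ≤ r - F by linarith
    -- The first 1 is the active error; `|r - m| + 1` bounds `r - γ s + ε` for ε < 1.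
    refine hlim (c := 1 + (|r - m| + 1)) fun ε hε hε1 => ?_
    refine apply_le_of_mem_wstarClosedConvexHull (hxs ε hε) fun w hw => ?_
    obtain ⟨u, hu, v, hv, rfl⟩ := Set.mem_add.1 hw
    obtain ⟨t, ht, hu⟩ := mem_iUnion₂.1 hu
    have h1 := hsub hu hr
    rw [hγact t ht] at h1
    have h2 : v (y - x) ≤ ε * (|r - m| + 1) := by
      have hpos : 0 ≤ ε * (|r - m| + 1) := by positivity
      rcases hv with ⟨s, -, hv⟩ | ⟨-, rfl⟩
      · obtain ⟨l, hl, v, hv', rfl⟩ := Set.mem_smul.1 hv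
        have e : (l • v) (y - x) = l * v (y - x) := rfl
        rcases hl with rfl | rfl
        · rwa [e, zero_mul]
        · rw [e]
          gcongr
          linarith [hsub hv' hr, hmγ s, le_abs_self (r - m)]
      · exact hpos
    have e : (u + v) (y - x) = u (y - x) + v (y - x) := rfl
    rw [e]
    linarith
  · intro xs hxs
    simp only [mem_iInter]
    refine fun ε hε => mem_wstarClosedConvexHull_of_forall_le fun z p hp => ?_
    refine apply_le_of_mem_subdiff_supFun hf husc hF hγ hε
      (fun t ht u hu => hp u (Or.inl (mem_biUnion ht hu))) (fun t ht => ?_) hxs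
    refine ⟨p / ε, fun u hu => ?_⟩
    have h1 : ε * u z ≤ p := hp (ε • u) (Or.inr (mem_biUnion ht (Set.smul_mem_smul_set hu)))
    rw [le_div_iff₀ hε]
    linarith
  · intro xs hxs
    simp only [mem_iInter] at hxs
    refine (mem_epsSubdiff_iff hF).2 ⟨le_rfl, fun y r hr => ?_⟩
    -- Minimality enters here: an inactive term now stands alone, and its bound O(ε) suffices only
    -- because `0 ≤ r - F`.
    have hFr : F ≤ r := by exact_mod_cast hF ▸ (hmin y).trans hr
    suffices xs (y - x) ≤ r - F by linarith
    refine hlim (c := |r - m| + 1) fun ε hε hε1 => ?_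
    refine apply_le_of_mem_wstarClosedConvexHull (hxs ε hε) fun w hw => ?_
    rcases hw with hw | hw
    · obtain ⟨t, ht, hw⟩ := mem_iUnion₂.1 hw
      have h1 := hsub hw hr
      rw [hγact t ht] at h1
      nlinarith [abs_nonneg (r - m)]
    · obtain ⟨s, -, v, hv, rfl⟩ := mem_iUnion₂.1 hw
      have e : (ε • v) (y - x) = ε * v (y - x) := rfl
      have h1 : ε * v (y - x) ≤ ε * (|r - m| + 1) := by
        gcongr
        linarith [hsub hv hr, hmγ s, le_abs_self (r - m)]
      change (ε • v) (y - x) ≤ _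
      rw [e]
      linarith
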